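/- Let $G$ be a hyperbolic group and let $H\le G$ be a subgroup that is itself a hyperbolic group (a group is hyperbolic if its Cayley graph with respect to some finite generating set is Gromov hyperbolic). Let $T$ be a finite generating set of $H$ and $S\supseteq T$ a finite generating set of $G$, let $\Gamma_H\subseteq\Gamma_G$ be the corresponding Cayley graphs, and let $i\colon\Gamma_H\to\Gamma_G$ be the inclusion. Let $\partial H$ and $\partial G$ be the Gromov boundaries (asymptote classes of geodesic rays) of $\Gamma_H$ and $\Gamma_G$, and give $\Gamma_H\cup\partial H$ and $\Gamma_G\cup\partial G$ the Gromov topology. For $\xi\in\partial H$ let $[1,\xi)_H$ denote a geodesic ray of $\Gamma_H$ that starts at $1$ and represents $\xi$. Such a ray lands at $\zeta\in\partial G$ if its image $i([1,\xi)_H)$ converges to $\zeta$ in $\Gamma_G\cup\partial G$. Let $\xi\neq\eta$ be points of $\partial H$ such that $[1,\xi)_H$ and $[1,\eta)_H$ land at the same point of $\partial G$. Assume that for some $K\ge 1$ and $\varepsilon\ge 0$ the ray $[1,\xi)_H$, included in $\Gamma_G$ by $i$, is a $(K,\varepsilon)$-quasigeodesic of $\Gamma_G$, that is, any two of its points, at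 distance $\ell$ in $\Gamma_H$, are at distance between $\frac1K\ell-\varepsilon$ and $K\ell+\varepsilon$ in $\Gamma_G$. Then the pair $(H,G)$ admits no Cannon–Thurston map: there is no map $\partial i\colon\partial H\to\partial G$ such that $i\cup\partial i\colon\Gamma_H\cup\partial H\to\Gamma_G\cup\partial G$ is continuous. -/

import Mathlib

open Filter Topology

noncomputable section

namespace HypGroup

variable {V : Type*}

/-- The Gromov product `(x|y)_o` of two vertices of a graph with its path metric. -/
def gromovProduct (Γ : SimpleGraph V) (o x y : V) : ℝ :=
  ((Γ.dist x o : ℝ) + (Γ.dist y o : ℝ) - (Γ.dist x y : ℝ)) / 2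

/-- Gromov hyperbolicity of (the vertex set of) a connected graph with its path metric. -/
def IsGromovHyperbolic (Γ : SimpleGraph V) : Prop :=
  Γ.Connected ∧ ∃ δ : ℝ, ∀ o x y z : V,
    min (gromovProduct Γ o x y) (gromovProduct Γ o y z) - δ ≤ gromovProduct Γ o x z

/-- A group is hyperbolic if it has a finite generating set whose Cayley graph is
Gromov hyperbolic. -/
def IsHyperbolicGroup (G : Type*) [Group G] : Prop :=
  ∃ S : Set G, S.Finite ∧ Subgroup.closure S = ⊤ ∧ IsGromovHyperbolic (SimpleGraph.mulCayley S)

/-- A geodesic ray in a graph, recorded by the vertices through which it passes at integer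
times. -/
structure GeodesicRay (Γ : SimpleGraph V) where
  toFun : ℕ → V
  isometry' : ∀ m n : ℕ, (Γ.dist (toFun m) (toFun n) : ℝ) = |(m : ℝ) - (n : ℝ)|

instance (Γ : SimpleGraph V) : CoeFun (GeodesicRay Γ) (fun _ => ℕ → V) := ⟨GeodesicRay.toFun⟩

/-- Two geodesic rays are asymptotic if they stay at bounded distance from each other. In the
absence of connectedness, `SimpleGraph.edist` (infinite between components) is used so that the
relation is transitive. -/
def Asymptotic (Γ : SimpleGraph V) (r s : GeodesicRay Γ) : Prop :=
  ∃ C : ℕ, ∀ n : ℕ, Γ.edist (r n) (s n) ≤ (C : ℕ∞)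

/-- The asymptote relation as a setoid on geodesic rays. -/
def asymptoticSetoid (Γ : SimpleGraph V) : Setoid (GeodesicRay Γ) where
  r := Asymptotic Γ
  iseqv :=
    { refl := fun r => ⟨0, fun n => by simp⟩
      symm := by
        rintro r s ⟨C, hC⟩
        exact ⟨C, fun n => by rw [SimpleGraph.edist_comm]; exact hC n⟩
      trans := by
        rintro r s t ⟨C, hC⟩ ⟨D, hD⟩
        refine ⟨C + D, fun n => ?_⟩
        push_cast
        exact (SimpleGraph.edist_triangle (v := s n)).trans (add_le_add (hC n) (hD n)) }

/-- The Gromov boundary: asymptote classes of geodesic rays. -/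
def Boundary (Γ : SimpleGraph V) : Type _ := Quotient (asymptoticSetoid Γ)

/-- `r` is a geodesic ray `[o, ξ)`: it starts at the vertex `o` and its asymptote class is
`ξ`. -/
def GeodesicRay.Joins {Γ : SimpleGraph V} (r : GeodesicRay Γ) (o : V) (ξ : Boundary Γ) : Prop :=
  r 0 = o ∧ (Quotient.mk (asymptoticSetoid Γ) r : Boundary Γ) = ξ

/-- The union of (the vertex set of) a graph and its Gromov boundary. The base point `o` is
used to describe the topology. -/
inductive Bordification (Γ : SimpleGraph V) (o : V) : Type _
  | pt : V → Bordification Γ o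
  | bd : Boundary Γ → Bordification Γ o

/-- The basic neighbourhood `V(ξ, R)` of a boundary point `ξ`: the vertices `y` such that
`lim_i (r i | y)_o ≥ R` for some geodesic ray `r = [o, ξ)`, together with the boundary
points `η` such that `liminf_{i,j} (r i | s j)_o ≥ R` for some geodesic rays
`r = [o, ξ)`, `s = [o, η)`. Gromov products of vertices are half-integers, so that
"the lower limit is at least `R`" is the same as "eventually at least `R`". -/
def basicNhd {Γ : SimpleGraph V} {o : V} (ξ : Boundary Γ) (R : ℝ) : Set (Bordification Γ o) :=
  {p | match p with
    | .pt y => ∃ r : GeodesicRay Γ, r.Joins o ξ ∧ ∀ᶠ i in atTop, R ≤ gromovProduct Γ o (r i) y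
    | .bd η => ∃ r s : GeodesicRay Γ, r.Joins o ξ ∧ s.Joins o η ∧
        ∀ᶠ ij : ℕ × ℕ in atTop, R ≤ gromovProduct Γ o (r ij.1) (s ij.2)}

/-- The basic neighbourhoods shrink as `R` grows. -/
theorem basicNhd_anti {Γ : SimpleGraph V} {o : V} (ξ : Boundary Γ) {R R' : ℝ} (h : R ≤ R') :
    (basicNhd ξ R' : Set (Bordification Γ o)) ⊆ basicNhd ξ R := by
  rintro (y | η) hp
  · obtain ⟨r, hr, h1⟩ := hp
    exact ⟨r, hr, h1.mono fun _ hi => h.trans hi⟩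
  · obtain ⟨r, s, hr, hs, h1⟩ := hp
    exact ⟨r, s, hr, hs, h1.mono fun _ hi => h.trans hi⟩

/-- The Gromov topology on the union of the vertex set and the boundary: vertices are isolated,
and a set is open if with each of its boundary points `ξ` it contains some `V(ξ, R)`. -/
instance (Γ : SimpleGraph V) (o : V) : TopologicalSpace (Bordification Γ o) where
  IsOpen U := ∀ ξ : Boundary Γ, Bordification.bd ξ ∈ U → ∃ R : ℝ, basicNhd ξ R ⊆ U
  isOpen_univ := fun _ _ => ⟨0, Set.subset_univ _⟩
  isOpen_inter := by
    rintro U W hU hW ξ ⟨h1, h2⟩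
    obtain ⟨R, hR⟩ := hU ξ h1
    obtain ⟨R', hR'⟩ := hW ξ h2
    exact ⟨max R R', Set.subset_inter ((basicNhd_anti ξ (le_max_left _ _)).trans hR)
      ((basicNhd_anti ξ (le_max_right _ _)).trans hR')⟩
  isOpen_sUnion := by
    rintro 𝒰 h ξ ⟨U, hU, hξ⟩
    obtain ⟨R, hR⟩ := h U hU ξ hξ
    exact ⟨R, hR.trans (Set.subset_sUnion_of_mem hU)⟩

section Subgroups

variable {G : Type*} [Group G] (H : Subgroup G) (T : Set H) (S : Set G)

/-- The inclusion of `H` into `G` extended by a map of the boundaries. -/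
def extendInclusion
    (f : Boundary (SimpleGraph.mulCayley T) → Boundary (SimpleGraph.mulCayley S)) :
    Bordification (SimpleGraph.mulCayley T) (1 : H) →
      Bordification (SimpleGraph.mulCayley S) (1 : G)
  | .pt h => .pt (h : G)
  | .bd ξ => .bd (f ξ)

/-- The pair `(H, G)`, with Cayley graphs given by `T` and `S`, admits a Cannon--Thurston map:
the inclusion extends continuously to a map from `∂H` to `∂G`. -/
def AdmitsCannonThurstonMap : Prop :=
  ∃ f : Boundary (SimpleGraph.mulCayley T) → Boundary (SimpleGraph.mulCayley S),
    Continuous (extendInclusion H T S f)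

/-- The geodesic ray `r` of the Cayley graph of `H` lands at the point `ζ` of `∂G`: the inclusion
of the ray into the Cayley graph of `G` extends continuously by sending its endpoint to `ζ`. -/
def LandsAt (r : GeodesicRay (SimpleGraph.mulCayley T))
    (ζ : Boundary (SimpleGraph.mulCayley S)) : Prop :=
  Tendsto (fun n : ℕ =>
      (Bordification.pt (r n : G) : Bordification (SimpleGraph.mulCayley S) (1 : G)))
    atTop (𝓝 (Bordification.bd ζ))

/-- The weak Cannon--Thurston pre-lamination: pairs `ξ ≠ η` of points of `∂H` such that
the rays `[1, ξ)` and `[1, η)` land at the same point of `∂G`. -/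
def weakCTPrelamination :
    Set (Boundary (SimpleGraph.mulCayley T) × Boundary (SimpleGraph.mulCayley T)) :=
  {p | p.1 ≠ p.2 ∧ ∃ r s : GeodesicRay (SimpleGraph.mulCayley T),
    r.Joins 1 p.1 ∧ s.Joins 1 p.2 ∧
      ∃ ζ : Boundary (SimpleGraph.mulCayley S), LandsAt H T S r ζ ∧ LandsAt H T S s ζ}

/-- The geodesic ray `r` of the Cayley graph of `H` is a `(K, ε)`-quasigeodesic in the Cayley
graph of `G`. -/
def IsQuasigeodesicIn (K ε : ℝ) (r : GeodesicRay (SimpleGraph.mulCayley T)) : Prop :=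
  ∀ m n : ℕ,
    1 / K * |(m : ℝ) - (n : ℝ)| - ε ≤ ((SimpleGraph.mulCayley S).dist (r m : G) (r n : G) : ℝ) ∧
    ((SimpleGraph.mulCayley S).dist (r m : G) (r n : G) : ℝ) ≤ K * |(m : ℝ) - (n : ℝ)| + ε

end Subgroups

end HypGroup

end

namespace HypGroup

variable {V : Type*}

/-! ### Four-point hyperbolicity -/

/-! Suppose a Cannon–Thurston map exists, and let `r`, `s` be rays of `H` to `ξ`, `η`, with `r` a
quasigeodesic of `G`. Gromov products satisfy a triangle-type inequality up to `δ`, and the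
contradiction comes from applying it once in `G`, at the base point `r n`, to the points `r m`, `s
m`, `1` with `m` much larger than `n`. In `H` the products `(r n|s m)_1` are bounded because `ξ ≠
η`, so `(s m|1)_{r n}` grows with `n`. Mitra's criterion (`exists_le_gromovProduct_of_continuous`)
makes the corresponding product in `G` large as well. In `G` both rays have the same limit, so for
fixed `n` the product `(r m|s m)_{r n}` is large once `m` is. Hence `(r m|1)_{r n}` is large in `G`.
But `r n` lies on a quasigeodesic from `1` to `r m`, so this product is bounded independently of `n`
and `m` (`exists_gromovProduct_quasigeodesic_le`). Mitra's criterion is a compactness argument: a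
sequence of counterexample pairs would converge to one point of `∂H`, and continuity would force
their products in `G` to infinity. Stability of quasigeodesics rests on `le_of_chain`, where the
loss is only logarithmic in the length. It also shows that hyperbolicity passes between finite
generating sets. -/

/-- The graph is connected and satisfies the four-point condition with constant `δ ≥ 0`. -/
structure IsHyperbolicWith (Γ : SimpleGraph V) (δ : ℝ) : Prop where
  connected : Γ.Connected
  nonneg : 0 ≤ δ
  min_sub_le : ∀ o x y z : V,
    min (gromovProduct Γ o x y) (gromovProduct Γ o y z) - δ ≤ gromovProduct Γ o x z

theorem IsGromovHyperbolic.exists_isHyperbolicWith {Γ : SimpleGraph V}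
    (h : IsGromovHyperbolic Γ) : ∃ δ, IsHyperbolicWith Γ δ := by
  obtain ⟨hc, δ, hδ⟩ := h
  refine ⟨max δ 0, hc, le_max_right _ _, fun o x y z => ?_⟩
  linarith [hδ o x y z, le_max_left δ 0]

theorem dist_triangle_real {Γ : SimpleGraph V} (hc : Γ.Connected) (x y z : V) :
    (Γ.dist x z : ℝ) ≤ Γ.dist x y + Γ.dist y z := by
  exact_mod_cast hc.dist_triangle

theorem dist_comm_real (Γ : SimpleGraph V) (x y : V) : (Γ.dist x y : ℝ) = Γ.dist y x := by
  rw [SimpleGraph.dist_comm]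

theorem dist_nonneg_real (Γ : SimpleGraph V) (x y : V) : (0 : ℝ) ≤ Γ.dist x y :=
  Nat.cast_nonneg _

theorem gromovProduct_comm (Γ : SimpleGraph V) (o x y : V) :
    gromovProduct Γ o x y = gromovProduct Γ o y x := by
  unfold gromovProduct
  rw [dist_comm_real Γ x y]
  ring

theorem gromovProduct_self (Γ : SimpleGraph V) (o x : V) :
    gromovProduct Γ o x x = Γ.dist x o := by
  simp [gromovProduct]

theorem gromovProduct_le_dist {Γ : SimpleGraph V} (hc : Γ.Connected) (o x y : V) :
    gromovProduct Γ o x y ≤ Γ.dist x o := by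
  unfold gromovProduct
  linarith [dist_triangle_real hc y x o, dist_comm_real Γ x y]

/-- Moving the base point changes the Gromov product at most by the distance moved. -/
theorem gromovProduct_le_add_dist {Γ : SimpleGraph V} (hc : Γ.Connected) (o p x y : V) :
    gromovProduct Γ o x y ≤ gromovProduct Γ p x y + Γ.dist o p := by
  unfold gromovProduct
  linarith [dist_triangle_real hc x p o, dist_triangle_real hc y p o, dist_comm_real Γ o p]

theorem gromovProduct_add_gromovProduct (Γ : SimpleGraph V) (o p x : V) :
    gromovProduct Γ o x p + gromovProduct Γ p x o = Γ.dist o p := by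
  unfold gromovProduct
  rw [dist_comm_real Γ p o]
  ring

theorem IsHyperbolicWith.le_gromovProduct_trans {Γ : SimpleGraph V} {δ : ℝ}
    (h : IsHyperbolicWith Γ δ)
    {o x y z : V} {a : ℝ} (h1 : a ≤ gromovProduct Γ o x y) (h2 : a ≤ gromovProduct Γ o y z) :
    a - δ ≤ gromovProduct Γ o x z := by
  linarith [h.min_sub_le o x y z, le_min h1 h2]

/-- Iterating the four-point condition along a chain of `2 ^ k` steps loses only `k * δ`. -/
theorem IsHyperbolicWith.le_of_chain {Γ : SimpleGraph V} {δ : ℝ} (h : IsHyperbolicWith Γ δ)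
    {o : V} {a : ℝ} (k : ℕ) : ∀ (q : ℕ → V) (n : ℕ), 1 ≤ n → n ≤ 2 ^ k →
      (∀ i < n, a ≤ gromovProduct Γ o (q i) (q (i + 1))) →
      a - k * δ ≤ gromovProduct Γ o (q 0) (q n) := by
  induction k with
  | zero =>
    intro q n h1 h2 hq
    obtain rfl : n = 1 := by simp at h2; omega
    simpa using hq 0 one_pos
  | succ k ih =>
    intro q n h1 h2 hq
    have hδ := h.nonneg
    push_cast
    by_cases hn : n ≤ 2 ^ k
    · linarith [ih q n h1 hn hq]
    -- Bisection: each half loses `k * δ`, and joining the halves costs one more `δ`.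
    · have h3 : n - 2 ^ k ≤ 2 ^ k := by rw [pow_succ] at h2; omega
      have e1 := ih q (2 ^ k) Nat.one_le_two_pow le_rfl fun i hi => hq i (by omega)
      have e2 := ih (fun i => q (2 ^ k + i)) (n - 2 ^ k) (by omega) h3
        fun i hi => hq (2 ^ k + i) (by omega)
      simp only [add_zero] at e2
      rw [show 2 ^ k + (n - 2 ^ k) = n by omega] at e2
      linarith [h.le_gromovProduct_trans e1 e2]

/-! ### Geodesic segments -/

/-- `γ 0, …, γ L` are the consecutive vertices of a geodesic. -/
def IsGeodesicSegment (Γ : SimpleGraph V) (γ : ℕ → V) (L : ℕ) : Prop :=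
  ∀ i j, i ≤ j → j ≤ L → (Γ.dist (γ i) (γ j) : ℝ) = j - i

theorem exists_isGeodesicSegment {Γ : SimpleGraph V} (hc : Γ.Connected) (x y : V) :
    ∃ γ : ℕ → V, γ 0 = x ∧ γ (Γ.dist x y) = y ∧ IsGeodesicSegment Γ γ (Γ.dist x y) := by
  obtain ⟨w, hw⟩ := hc.exists_walk_length_eq_dist x y
  have step : ∀ i d, Γ.dist (w.getVert i) (w.getVert (i + d)) ≤ d := by
    intro i d
    induction d with
    | zero => simp
    | succ d ih =>
      have h1 : Γ.dist (w.getVert (i + d)) (w.getVert (i + (d + 1))) ≤ 1 := by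
        by_cases hi : i + d < w.length
        · exact (SimpleGraph.dist_eq_one_iff_adj.2 (w.adj_getVert_succ hi)).le
        -- `getVert` is constant past the end of the walk, so the bound holds for all indices.
        · rw [w.getVert_of_length_le (by omega), w.getVert_of_length_le (by omega)]
          simp
      exact (hc.dist_triangle (v := w.getVert (i + d))).trans (add_le_add ih h1)
  refine ⟨w.getVert, w.getVert_zero, hw ▸ w.getVert_length, fun i j hij hj => ?_⟩
  have h1 := step 0 i
  have h2 := step i (j - i)
  have h3 := step j (Γ.dist x y - j)
  rw [zero_add, w.getVert_zero] at h1
  rw [show i + (j - i) = j by omega] at h2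
  rw [show j + (Γ.dist x y - j) = Γ.dist x y by omega, ← hw, w.getVert_length, hw] at h3
  have h4 : Γ.dist x y ≤ Γ.dist x (w.getVert i) + Γ.dist (w.getVert i) y := hc.dist_triangle
  have h5 : Γ.dist (w.getVert i) y ≤
    Γ.dist (w.getVert i) (w.getVert j) + Γ.dist (w.getVert j) y := hc.dist_triangle
  have h6 : Γ.dist (w.getVert i) (w.getVert j) = j - i := by omega
  rw [h6]
  push_cast [hij]
  ring

/-- A geodesic from `x` to `y` passes `o` at a distance of about the Gromov product. -/
theorem IsHyperbolicWith.exists_dist_geodesic_le {Γ : SimpleGraph V} {δ : ℝ}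
    (h : IsHyperbolicWith Γ δ) {γ : ℕ → V} {L : ℕ} (hγ : IsGeodesicSegment Γ γ L) (o : V) :
    ∃ t ≤ L, (Γ.dist o (γ t) : ℝ) ≤ gromovProduct Γ o (γ 0) (γ L) + 2 * δ + 1 := by
  have hc := h.connected
  have hL := hγ 0 L (Nat.zero_le _) le_rfl
  have t0 : 0 ≤ gromovProduct Γ (γ 0) o (γ L) := by
    unfold gromovProduct
    linarith [dist_triangle_real hc o (γ 0) (γ L), dist_comm_real Γ (γ 0) (γ L)]
  have t1 : gromovProduct Γ (γ 0) o (γ L) ≤ L := by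
    rw [gromovProduct_comm]
    refine (gromovProduct_le_dist hc _ _ _).trans ?_
    rw [dist_comm_real, hL]; simp
  -- The tangency point on the geodesic of the circle inscribed in the triangle with apex `o`;
  -- rounding it down to a vertex costs the final `+ 1`.
  set t := ⌊gromovProduct Γ (γ 0) o (γ L)⌋₊ with ht
  have ht1 : (t : ℝ) ≤ gromovProduct Γ (γ 0) o (γ L) := Nat.floor_le t0
  have ht2 : gromovProduct Γ (γ 0) o (γ L) < t + 1 := Nat.lt_floor_add_one _
  have htL : t ≤ L := by exact_mod_cast ht1.trans t1
  refine ⟨t, htL, ?_⟩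
  have a1 := hγ 0 t (Nat.zero_le _) htL
  have a2 := hγ t L htL le_rfl
  have key := h.min_sub_le o (γ 0) (γ t) (γ L)
  unfold gromovProduct at *
  rw [dist_comm_real Γ (γ t) o] at key
  rw [dist_comm_real Γ (γ L) (γ 0), dist_comm_real Γ o (γ 0), dist_comm_real Γ o (γ L)] at ht1 ht2
  push_cast at *
  rcases min_choice (((Γ.dist (γ 0) o : ℝ) + Γ.dist o (γ t) - Γ.dist (γ 0) (γ t)) / 2)
    (((Γ.dist o (γ t) : ℝ) + Γ.dist (γ L) o - Γ.dist (γ t) (γ L)) / 2) with e | e <;>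
    rw [e] at key <;> linarith

/-- If `P` holds at time `0`, then up to time `L` either it holds at `L` or it fails right after
a time at which it holds. -/
theorem exists_last_of_not {P : ℕ → Prop} {L : ℕ} (h0 : P 0) :
    ∃ t ≤ L, P t ∧ (t = L ∨ ¬ P (t + 1)) := by
  induction L with
  | zero => exact ⟨0, le_rfl, h0, Or.inl rfl⟩
  | succ L ih =>
    obtain ⟨t, ht, hP, rfl | hn⟩ := ih
    · by_cases h : P (t + 1)
      · exact ⟨t + 1, le_rfl, h, Or.inl rfl⟩
      · exact ⟨t, by omega, hP, Or.inr h⟩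
    · exact ⟨t, by omega, hP, Or.inr hn⟩

/-! ### Stability of quasigeodesics -/

/-- `q 0, …, q N` is a discrete quasigeodesic with jumps at most `J`, whose indices are controlled
by distances. -/
structure IsQuasigeodesicSegment (Γ : SimpleGraph V) (K ε J : ℝ) (q : ℕ → V) (N : ℕ) : Prop where
  jump_le : ∀ i < N, (Γ.dist (q i) (q (i + 1)) : ℝ) ≤ J
  sub_le : ∀ i j, i ≤ j → j ≤ N → (j : ℝ) - i ≤ K * (Γ.dist (q i) (q j) + ε)

theorem IsQuasigeodesicSegment.dist_le {Γ : SimpleGraph V} (hc : Γ.Connected) {K ε J : ℝ}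
    {q : ℕ → V} {N : ℕ} (h : IsQuasigeodesicSegment Γ K ε J q N) {i j : ℕ} (hij : i ≤ j)
    (hj : j ≤ N) : (Γ.dist (q i) (q j) : ℝ) ≤ J * ((j : ℝ) - i) := by
  induction j, hij using Nat.le_induction with
  | base => simp
  | succ j hij ih =>
    push_cast
    linarith [ih (by omega), h.jump_le j (by omega), dist_triangle_real hc (q i) (q j) (q (j + 1))]

/-- A quantity that is at most logarithmic in itself is bounded. -/
theorem exists_bound_of_le_log {δ J : ℝ} (hδ : 0 ≤ δ) (hJ : 0 ≤ J) (a b : ℝ) (ha : 0 ≤ a) :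
    ∃ D₀ : ℝ, 0 ≤ D₀ ∧ ∀ D : ℝ, (∀ k : ℕ, a * D + b ≤ 2 ^ k → D ≤ J + (k + 2) * δ) → D ≤ D₀ := by
  -- Unlike `δ`, this is positive, and it makes the last comparison strict.
  set e := δ + 1 with he
  have hlim : Tendsto (fun k : ℕ => (a * (J + (k + 3) * e) + b) / 2 ^ k) atTop (𝓝 0) := by
    have h1 : Tendsto (fun k : ℕ => (k : ℝ) ^ 1 / 2 ^ k) atTop (𝓝 0) :=
      tendsto_pow_const_div_const_pow_of_one_lt 1 one_lt_two
    have h0 : Tendsto (fun k : ℕ => (k : ℝ) ^ 0 / 2 ^ k) atTop (𝓝 0) :=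
      tendsto_pow_const_div_const_pow_of_one_lt 0 one_lt_two
    have := (h1.const_mul (a * e)).add (h0.const_mul (a * (J + 3 * e) + b))
    simp only [mul_zero, add_zero] at this
    refine this.congr fun k => ?_
    simp only [pow_one, pow_zero]
    ring
  obtain ⟨k₀, hk₀⟩ := eventually_atTop.1 (hlim.eventually_lt_const one_pos)
  have hk : ∀ k ≥ k₀, a * (J + (k + 3) * e) + b ≤ 2 ^ k := fun k hk => by
    have := hk₀ k hk
    rw [div_lt_one (by positivity)] at this
    exact this.le
  have hepos : 0 < e := by linarith
  refine ⟨J + (k₀ + 3) * e, by positivity, fun D hD => ?_⟩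
  by_contra! hlt
  have hx : (k₀ : ℝ) + 3 < (D - J) / e := by rw [lt_div_iff₀ hepos]; linarith
  have hx0 : 0 ≤ (D - J) / e := by linarith [(Nat.cast_nonneg k₀ : (0 : ℝ) ≤ k₀)]
  -- Now `J + (m + 3) * e ≤ D < J + (m + 4) * e`, so `k = m + 1` is admissible and gives `D ≤ J + (m
  -- + 3) * δ`, a contradiction.
  obtain ⟨m, hm⟩ : ∃ m, ⌊(D - J) / e⌋₊ = m + 3 := by
    have : k₀ + 3 ≤ ⌊(D - J) / e⌋₊ := Nat.le_floor (by push_cast; exact hx.le)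
    exact ⟨⌊(D - J) / e⌋₊ - 3, by omega⟩
  have f1 := Nat.floor_le hx0
  have f2 := Nat.lt_floor_add_one ((D - J) / e)
  rw [hm] at f1 f2
  push_cast at f1 f2
  rw [le_div_iff₀ hepos] at f1
  rw [div_lt_iff₀ hepos] at f2
  have hmk : k₀ ≤ m + 1 := by
    have : k₀ + 3 ≤ m + 3 := hm ▸ Nat.le_floor (by push_cast; exact hx.le)
    omega
  have g1 := hk (m + 1) hmk
  push_cast at g1
  have g2 := hD (m + 1) (le_trans (by
    have : a * D ≤ a * (J + (m + 1 + 3) * e) := mul_le_mul_of_nonneg_left (by linarith) ha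
    linarith) g1)
  push_cast at g2
  have : ((m : ℝ) + 1 + 2) * δ < (m + 3) * e := by
    rw [he]; nlinarith [(Nat.cast_nonneg m : (0 : ℝ) ≤ m)]
  linarith

theorem le_gromovProduct_of_far {Γ : SimpleGraph V} {o x y : V} {D J : ℝ}
    (hx : D ≤ Γ.dist x o) (hy : D ≤ Γ.dist y o) (h : (Γ.dist x y : ℝ) ≤ J) :
    D - J / 2 ≤ gromovProduct Γ o x y := by
  unfold gromovProduct
  linarith

/-- A quasigeodesic which avoids the ball of radius `D` around `o` has endpoints with large
Gromov product, up to the logarithm of its length. -/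
theorem IsHyperbolicWith.le_gromovProduct_of_avoid {Γ : SimpleGraph V} {δ : ℝ}
    (h : IsHyperbolicWith Γ δ) {K ε J : ℝ} (hJ : 0 ≤ J) {q : ℕ → V} {N : ℕ}
    (hq : IsQuasigeodesicSegment Γ K ε J q N) {o : V} {D : ℝ}
    (hD : ∀ i ≤ N, D ≤ Γ.dist (q i) o) {k i j : ℕ} (hi : i ≤ N) (hj : j ≤ N)
    (hk : K * (Γ.dist (q i) (q j) + ε) ≤ 2 ^ k) :
    D - J / 2 - k * δ ≤ gromovProduct Γ o (q i) (q j) := by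
  wlog hij : i ≤ j generalizing i j
  · rw [gromovProduct_comm]
    exact this hj hi (by rwa [dist_comm_real]) (by omega)
  have hδ := h.nonneg
  rcases hij.eq_or_lt with rfl | hlt
  · rw [gromovProduct_self]
    have : 0 ≤ k * δ := by positivity
    linarith [hD i hi]
  · have hn : ((j - i : ℕ) : ℝ) ≤ ((2 ^ k : ℕ) : ℝ) := by
      push_cast [hij]
      exact (hq.sub_le i j hij hj).trans hk
    have := h.le_of_chain (o := o) (a := D - J / 2) k (fun l => q (i + l)) (j - i) (by omega)
      (by exact_mod_cast hn) fun l hl =>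
        le_gromovProduct_of_far (hD _ (by omega)) (hD _ (by omega)) (hq.jump_le (i + l) (by omega))
    simpa [show i + (j - i) = j by omega] using this

/-- Geodesics stay close to quasigeodesics with the same endpoints. -/
theorem IsHyperbolicWith.exists_geodesic_near_quasigeodesic {Γ : SimpleGraph V} {δ : ℝ}
    (h : IsHyperbolicWith Γ δ) {K ε J : ℝ} (hK : 0 ≤ K) (hJ : 0 ≤ J) :
    ∃ D₀ : ℝ, 0 ≤ D₀ ∧ ∀ (q : ℕ → V) (N : ℕ), IsQuasigeodesicSegment Γ K ε J q N →
      ∀ (γ : ℕ → V) (L : ℕ), IsGeodesicSegment Γ γ L → γ 0 = q 0 → γ L = q N →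
        ∀ t ≤ L, ∃ i ≤ N, (Γ.dist (γ t) (q i) : ℝ) ≤ D₀ := by
  have hδ := h.nonneg
  have hc := h.connected
  -- The detour found below has endpoints at most `6 * D` apart, hence at most `K * (6 * D + ε)`
  -- steps.
  obtain ⟨D₀, h0, hD₀⟩ := exists_bound_of_le_log hδ hJ (6 * K) (K * ε) (by positivity)
  refine ⟨D₀, h0, fun q N hq γ L hγ e0 eN => ?_⟩
  -- the distance of a vertex of the geodesic to the quasigeodesic
  have hex : ∀ t, ∃ i ≤ N, ∀ j ≤ N, Γ.dist (γ t) (q i) ≤ Γ.dist (γ t) (q j) := fun t => by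
    obtain ⟨i, hi, hmin⟩ := (Finset.range (N + 1)).exists_min_image
      (fun i => Γ.dist (γ t) (q i)) ⟨0, by simp⟩
    exact ⟨i, by simpa [Nat.lt_succ_iff] using hi,
      fun j hj => hmin j (by simpa [Nat.lt_succ_iff] using hj)⟩
  choose n hnN hn using hex
  -- Extremal choice: `γ t` is farthest from the quasigeodesic, at distance `D`. All other vertices
  -- of the geodesic are within `D` of it, and it avoids the open `D`-ball around `γ t`.
  obtain ⟨t, ht, hmax⟩ := (Finset.range (L + 1)).exists_max_image
    (fun t => Γ.dist (γ t) (q (n t))) ⟨0, by simp⟩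
  have htL : t ≤ L := by simpa [Nat.lt_succ_iff] using ht
  replace hmax : ∀ s ≤ L, Γ.dist (γ s) (q (n s)) ≤ Γ.dist (γ t) (q (n t)) :=
    fun s hs => hmax s (by simpa [Nat.lt_succ_iff] using hs)
  set D := Γ.dist (γ t) (q (n t)) with hDdef
  suffices hD : (D : ℝ) ≤ D₀ from
    fun s hs => ⟨n s, hnN s, le_trans (by exact_mod_cast hmax s hs) hD⟩
  have far : ∀ i ≤ N, (D : ℝ) ≤ Γ.dist (q i) (γ t) := fun i hi => by
    rw [dist_comm_real Γ (q i) (γ t)]; exact_mod_cast hn t i hi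
  -- Going back `2 * D`, or to the endpoint if that is nearer, gives a vertex from which one can
  -- cross to the quasigeodesic with Gromov product at least `D` seen from `γ t`.
  have left : ∃ s ≤ t, t ≤ s + 2 * D ∧ ∃ i ≤ N, Γ.dist (γ s) (q i) ≤ D ∧
      (D : ℝ) ≤ gromovProduct Γ (γ t) (γ s) (q i) := by
    by_cases hs : 2 * D ≤ t
    · refine ⟨t - 2 * D, by omega, by omega, n (t - 2 * D), hnN _, hmax _ (by omega), ?_⟩
      have e1 := hγ (t - 2 * D) t (by omega) htL
      have e2 := far _ (hnN (t - 2 * D))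
      have e3 : (Γ.dist (γ (t - 2 * D)) (q (n (t - 2 * D))) : ℝ) ≤ D := by
        exact_mod_cast hmax _ (by omega)
      push_cast [hs] at e1
      unfold gromovProduct
      linarith
    · refine ⟨0, by omega, by omega, 0, by omega, by simp [e0], ?_⟩
      rw [e0, gromovProduct_self]
      exact far 0 (Nat.zero_le _)
  have right : ∃ s, t ≤ s ∧ s ≤ L ∧ s ≤ t + 2 * D ∧ ∃ i ≤ N, Γ.dist (γ s) (q i) ≤ D ∧
      (D : ℝ) ≤ gromovProduct Γ (γ t) (q i) (γ s) := by
    by_cases hs : t + 2 * D ≤ L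
    · refine ⟨t + 2 * D, by omega, hs, by omega, n (t + 2 * D), hnN _, hmax _ hs, ?_⟩
      have e1 := hγ t (t + 2 * D) (by omega) hs
      have e2 := far _ (hnN (t + 2 * D))
      have e3 : (Γ.dist (γ (t + 2 * D)) (q (n (t + 2 * D))) : ℝ) ≤ D := by
        exact_mod_cast hmax _ hs
      push_cast at e1
      rw [gromovProduct_comm]
      unfold gromovProduct
      linarith [dist_comm_real Γ (γ t) (γ (t + 2 * D))]
    · refine ⟨L, by omega, le_rfl, by omega, N, le_rfl, by simp [eN], ?_⟩
      rw [eN, gromovProduct_self]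
      exact far N le_rfl
  obtain ⟨s₁, hs₁, hs₁', i₁, hi₁, hd₁, hg₁⟩ := left
  obtain ⟨s₂, hs₂, hs₂L, hs₂', i₂, hi₂, hd₂, hg₂⟩ := right
  refine hD₀ D fun k hk => ?_
  have d1 : (Γ.dist (γ s₁) (q i₁) : ℝ) ≤ D := by exact_mod_cast hd₁
  have d2 : (Γ.dist (γ s₂) (q i₂) : ℝ) ≤ D := by exact_mod_cast hd₂
  have c1 : (t : ℝ) ≤ s₁ + 2 * D := by exact_mod_cast hs₁'
  have c2 : (s₂ : ℝ) ≤ t + 2 * D := by exact_mod_cast hs₂'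
  have hmid : (Γ.dist (q i₁) (q i₂) : ℝ) ≤ 6 * D := by
    have := hγ s₁ s₂ (hs₁.trans hs₂) hs₂L
    linarith [dist_triangle_real hc (q i₁) (γ s₁) (q i₂),
      dist_triangle_real hc (γ s₁) (γ s₂) (q i₂), dist_comm_real Γ (γ s₁) (q i₁)]
  have hkk : K * (Γ.dist (q i₁) (q i₂) + ε) ≤ 2 ^ k := by
    have := mul_le_mul_of_nonneg_left hmid hK
    linarith
  have g := h.le_gromovProduct_of_avoid hJ hq far hi₁ hi₂ hkk
  have hkδ : 0 ≤ k * δ := by positivity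
  have g1 := h.le_gromovProduct_trans (le_trans (by linarith) hg₁) g
  have g2 := h.le_gromovProduct_trans g1 (le_trans (by linarith) hg₂)
  -- The product vanishes since `γ t` is on the geodesic, while the detour bounds it below by `D - J
  -- / 2 - (k + 2) * δ`.
  have z : gromovProduct Γ (γ t) (γ s₁) (γ s₂) = 0 := by
    have z1 := hγ s₁ t hs₁ htL
    have z2 := hγ t s₂ hs₂ hs₂L
    have z3 := hγ s₁ s₂ (hs₁.trans hs₂) hs₂L
    rw [dist_comm_real] at z2
    unfold gromovProduct
    rw [z1, z2, z3]; ring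
  linarith

/-- Every vertex of a quasigeodesic lies between its endpoints, up to a bounded error. -/
theorem IsHyperbolicWith.exists_gromovProduct_quasigeodesic_le {Γ : SimpleGraph V} {δ : ℝ}
    (h : IsHyperbolicWith Γ δ) {K ε J : ℝ} (hK : 0 ≤ K) (hJ : 0 ≤ J) :
    ∃ A : ℝ, 0 ≤ A ∧ ∀ (q : ℕ → V) (N : ℕ), IsQuasigeodesicSegment Γ K ε J q N →
      ∀ b ≤ N, gromovProduct Γ (q b) (q 0) (q N) ≤ A := by
  have hc := h.connected
  obtain ⟨D₀, h0, hD₀⟩ := h.exists_geodesic_near_quasigeodesic (ε := ε) hK hJ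
  refine ⟨J * (K * (2 * D₀ + 1 + |ε|)) + D₀, by positivity, fun q N hq b hb => ?_⟩
  obtain ⟨γ, e0, eN, hγ⟩ := exists_isGeodesicSegment hc (q 0) (q N)
  set L := Γ.dist (q 0) (q N)
  have near := hD₀ q N hq γ L hγ e0 eN
  -- The last vertex of the geodesic near `q 0, …, q b` is also near the part from `q b` on. So `q
  -- i` and `q j` with `i ≤ b ≤ j` are close, which bounds `j - i` and traps `q b` near `γ t`.
  obtain ⟨t, htL, ⟨i, hi, hit⟩, htt⟩ := exists_last_of_not
    (P := fun t => ∃ i ≤ b, (Γ.dist (γ t) (q i) : ℝ) ≤ D₀) (L := L)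
    ⟨0, Nat.zero_le _, by simp [e0, h0]⟩
  have hj : ∃ j, b ≤ j ∧ j ≤ N ∧ (Γ.dist (γ t) (q j) : ℝ) ≤ D₀ + 1 := by
    rcases htt with rfl | hn
    · exact ⟨N, hb, le_rfl, by simp [eN]; linarith⟩
    · by_cases ht : t = L
      · exact ⟨N, hb, le_rfl, by simp [ht, eN]; linarith⟩
      · obtain ⟨j, hj, hd⟩ := near (t + 1) (by omega)
        refine ⟨j, ?_, hj, ?_⟩
        · by_contra hlt
          exact hn ⟨j, by omega, hd⟩
        · have := hγ t (t + 1) (by omega) (by omega)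
          push_cast at this
          linarith [dist_triangle_real hc (γ t) (γ (t + 1)) (q j)]
  obtain ⟨j, hbj, hjN, hjt⟩ := hj
  have dij : (Γ.dist (q i) (q j) : ℝ) ≤ 2 * D₀ + 1 := by
    linarith [dist_triangle_real hc (q i) (γ t) (q j), dist_comm_real Γ (γ t) (q i)]
  have hsub := hq.sub_le i j (hi.trans hbj) hjN
  have hib : (Γ.dist (q i) (q b) : ℝ) ≤ J * (K * (2 * D₀ + 1 + |ε|)) := by
    refine (hq.dist_le hc hi hb).trans (mul_le_mul_of_nonneg_left ?_ hJ)
    have hbj' : (b : ℝ) ≤ j := by exact_mod_cast hbj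
    have : K * (Γ.dist (q i) (q j) + ε) ≤ K * (2 * D₀ + 1 + |ε|) :=
      mul_le_mul_of_nonneg_left (add_le_add dij (le_abs_self ε)) hK
    linarith
  have z1 := hγ 0 t (Nat.zero_le _) htL
  have z2 := hγ t L htL le_rfl
  have z3 := hγ 0 L (Nat.zero_le _) le_rfl
  rw [e0] at z1 z3
  rw [eN] at z2 z3
  unfold gromovProduct
  linarith [dist_triangle_real hc (q 0) (γ t) (q b), dist_triangle_real hc (q N) (γ t) (q b),
    dist_triangle_real hc (γ t) (q i) (q b), dist_comm_real Γ (q N) (γ t)]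

/-- A quasigeodesic passes `o` at a distance bounded by the Gromov product of its endpoints. -/
theorem IsHyperbolicWith.exists_dist_quasigeodesic_le {Γ : SimpleGraph V} {δ : ℝ}
    (h : IsHyperbolicWith Γ δ) {K ε J : ℝ} (hK : 0 ≤ K) (hJ : 0 ≤ J) :
    ∃ A : ℝ, 0 ≤ A ∧ ∀ (q : ℕ → V) (N : ℕ), IsQuasigeodesicSegment Γ K ε J q N → ∀ o : V,
      ∃ i ≤ N, (Γ.dist o (q i) : ℝ) ≤ gromovProduct Γ o (q 0) (q N) + A := by
  have hc := h.connected
  have hδ := h.nonneg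
  obtain ⟨D₀, h0, hD₀⟩ := h.exists_geodesic_near_quasigeodesic (ε := ε) hK hJ
  refine ⟨2 * δ + 1 + D₀, by positivity, fun q N hq o => ?_⟩
  obtain ⟨γ, e0, eN, hγ⟩ := exists_isGeodesicSegment hc (q 0) (q N)
  obtain ⟨t, htL, ht⟩ := h.exists_dist_geodesic_le hγ o
  obtain ⟨i, hi, hd⟩ := hD₀ q N hq γ _ hγ e0 eN t htL
  rw [e0, eN] at ht
  exact ⟨i, hi, by linarith [dist_triangle_real hc o (γ t) (q i)]⟩

/-! ### Invariance of hyperbolicity -/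

/-- Geodesic triangles are `c`-slim. -/
def IsSlim (Γ : SimpleGraph V) (c : ℝ) : Prop :=
  ∀ (α β γ : ℕ → V) (a b l : ℕ), IsGeodesicSegment Γ α a → IsGeodesicSegment Γ β b →
    IsGeodesicSegment Γ γ l → γ 0 = α 0 → α a = β 0 → β b = γ l → ∀ t ≤ l,
      (∃ i ≤ a, (Γ.dist (γ t) (α i) : ℝ) ≤ c) ∨ ∃ i ≤ b, (Γ.dist (γ t) (β i) : ℝ) ≤ c

theorem IsGeodesicSegment.gromovProduct_le_dist {Γ : SimpleGraph V} (hc : Γ.Connected)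
    {γ : ℕ → V} {L : ℕ} (hγ : IsGeodesicSegment Γ γ L) (o : V) {t : ℕ} (ht : t ≤ L) :
    gromovProduct Γ o (γ 0) (γ L) ≤ Γ.dist o (γ t) := by
  have z1 := hγ 0 t (Nat.zero_le _) ht
  have z2 := hγ t L ht le_rfl
  have z3 := hγ 0 L (Nat.zero_le _) le_rfl
  unfold gromovProduct
  linarith [dist_triangle_real hc (γ 0) (γ t) o, dist_triangle_real hc (γ L) (γ t) o,
    dist_comm_real Γ (γ L) (γ t), dist_comm_real Γ o (γ t)]

/-- In a graph with slim triangles the Gromov product is about the distance to a geodesic. -/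
theorem IsSlim.exists_dist_le_gromovProduct {Γ : SimpleGraph V} {c : ℝ} (h : IsSlim Γ c)
    (hc : Γ.Connected) (hc0 : 0 ≤ c) {γ : ℕ → V} {L : ℕ} (hγ : IsGeodesicSegment Γ γ L) (o : V) :
    ∃ t ≤ L, (Γ.dist o (γ t) : ℝ) ≤ gromovProduct Γ o (γ 0) (γ L) + 2 * c + 1 := by
  obtain ⟨α, a0, a1, hα⟩ := exists_isGeodesicSegment hc (γ 0) o
  obtain ⟨β, b0, b1, hβ⟩ := exists_isGeodesicSegment hc o (γ L)
  have near := h α β γ _ _ L hα hβ hγ a0.symm (a1.trans b0.symm) b1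
  obtain ⟨t, htL, ⟨i, hi, hit⟩, htt⟩ := exists_last_of_not
    (P := fun t => ∃ i ≤ Γ.dist (γ 0) o, (Γ.dist (γ t) (α i) : ℝ) ≤ c) (L := L)
    ⟨0, Nat.zero_le _, by simp [a0, hc0]⟩
  have hj : ∃ j ≤ Γ.dist o (γ L), (Γ.dist (γ t) (β j) : ℝ) ≤ c + 1 := by
    by_cases ht : t = L
    · exact ⟨Γ.dist o (γ L), le_rfl, by simp [ht, b1]; linarith⟩
    · have hn := htt.resolve_left ht
      obtain ⟨j, hj, hd⟩ := (near (t + 1) (by omega)).resolve_left hn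
      refine ⟨j, hj, ?_⟩
      have := hγ t (t + 1) (by omega) (by omega)
      push_cast at this
      linarith [dist_triangle_real hc (γ t) (γ (t + 1)) (β j)]
  obtain ⟨j, hj, hjt⟩ := hj
  refine ⟨t, htL, ?_⟩
  have z1 := hγ 0 t (Nat.zero_le _) htL
  have z2 := hγ t L htL le_rfl
  have z3 := hγ 0 L (Nat.zero_le _) le_rfl
  have x1 := hα 0 i (Nat.zero_le _) hi
  have x2 := hα i _ hi le_rfl
  have y1 := hβ 0 j (Nat.zero_le _) hj
  have y2 := hβ j _ hj le_rfl
  rw [a0] at x1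
  rw [a1] at x2
  rw [b0] at y1
  rw [b1] at y2
  have e1 : (Γ.dist o (γ t) : ℝ) + Γ.dist (γ 0) (γ t) ≤ Γ.dist (γ 0) o + 2 * c := by
    push_cast at *
    linarith [dist_triangle_real hc o (α i) (γ t), dist_triangle_real hc (γ 0) (α i) (γ t),
      dist_comm_real Γ o (α i), dist_comm_real Γ (γ t) (α i)]
  have e2 : (Γ.dist o (γ t) : ℝ) + Γ.dist (γ t) (γ L) ≤ Γ.dist (γ L) o + 2 * c + 2 := by
    rw [dist_comm_real Γ (γ L) o]
    push_cast at *
    linarith [dist_triangle_real hc o (β j) (γ t), dist_triangle_real hc (γ t) (β j) (γ L),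
      dist_comm_real Γ (γ t) (β j)]
  unfold gromovProduct
  push_cast at *
  linarith

/-- Products at `o` are distances from `o` to sides, up to `2 * c + 1`; slimness moves a vertex of
one side to another for a further `c`. -/
theorem IsSlim.isHyperbolicWith {Γ : SimpleGraph V} {c : ℝ} (h : IsSlim Γ c)
    (hc : Γ.Connected) (hc0 : 0 ≤ c) : IsHyperbolicWith Γ (3 * c + 1) := by
  refine ⟨hc, by positivity, fun o x y z => ?_⟩
  obtain ⟨α, a0, a1, hα⟩ := exists_isGeodesicSegment hc x y
  obtain ⟨β, b0, b1, hβ⟩ := exists_isGeodesicSegment hc y z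
  obtain ⟨γ, c0, c1, hγ⟩ := exists_isGeodesicSegment hc x z
  obtain ⟨t, ht, hd⟩ := h.exists_dist_le_gromovProduct hc hc0 hγ o
  rw [c0, c1] at hd
  rcases h α β γ _ _ _ hα hβ hγ (c0.trans a0.symm) (a1.trans b0.symm) (b1.trans c1.symm) t ht with
    ⟨i, hi, hdi⟩ | ⟨i, hi, hdi⟩
  · have := hα.gromovProduct_le_dist hc o hi
    rw [a0, a1] at this
    linarith [dist_triangle_real hc o (γ t) (α i),
      min_le_left (gromovProduct Γ o x y) (gromovProduct Γ o y z)]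
  · have := hβ.gromovProduct_le_dist hc o hi
    rw [b0, b1] at this
    linarith [dist_triangle_real hc o (γ t) (β i),
      min_le_right (gromovProduct Γ o x y) (gromovProduct Γ o y z)]

/-- Hyperbolicity only depends on the metric up to bi-Lipschitz equivalence. -/
theorem IsHyperbolicWith.exists_of_biLipschitz {Γ Γ' : SimpleGraph V} {δ : ℝ}
    (h : IsHyperbolicWith Γ δ) (hc' : Γ'.Connected) {J K : ℝ} (hJ : 0 ≤ J) (hK : 0 ≤ K)
    (h1 : ∀ x y, (Γ.dist x y : ℝ) ≤ J * Γ'.dist x y)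
    (h2 : ∀ x y, (Γ'.dist x y : ℝ) ≤ K * Γ.dist x y) : ∃ δ', IsHyperbolicWith Γ' δ' := by
  have hδ := h.nonneg
  have hq : ∀ γ L, IsGeodesicSegment Γ' γ L → IsQuasigeodesicSegment Γ K 0 J γ L := by
    refine fun γ L hγ => ⟨fun i hi => ?_, fun i j hij hj => ?_⟩
    · have := hγ i (i + 1) (by omega) (by omega)
      push_cast at this
      have h3 := h1 (γ i) (γ (i + 1))
      rw [this] at h3
      linarith
    · rw [← hγ i j hij hj, add_zero]
      exact h2 _ _
  obtain ⟨A, hA, hA'⟩ := h.exists_gromovProduct_quasigeodesic_le (ε := 0) hK hJ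
  obtain ⟨B, hB, hB'⟩ := h.exists_dist_quasigeodesic_le (ε := 0) hK hJ
  -- Measured in `Γ`, the product at `γ t` of the ends of its side is at most `A`, so that of
  -- another side is at most `A + δ`, and that side passes within a further `B`. The factor `K`
  -- returns to `Γ'`.
  have hslim : IsSlim Γ' (K * (A + δ + B)) := by
    intro α β γ a b l hα hβ hγ e1 e2 e3 t ht
    have hm := hA' γ l (hq γ l hγ) t ht
    have key := h.min_sub_le (γ t) (α 0) (α a) (β b)
    rw [← e1, e3] at key
    obtain ⟨i, hi, hdi⟩ := hB' α a (hq α a hα) (γ t)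
    obtain ⟨j, hj, hdj⟩ := hB' β b (hq β b hβ) (γ t)
    rw [← e1] at hdi
    rw [← e2, e3] at hdj
    rcases min_choice (gromovProduct Γ (γ t) (γ 0) (α a)) (gromovProduct Γ (γ t) (α a) (γ l))
      with e | e <;> rw [e] at key
    · exact Or.inl ⟨i, hi, (h2 _ _).trans (mul_le_mul_of_nonneg_left (by linarith) hK)⟩
    · exact Or.inr ⟨j, hj, (h2 _ _).trans (mul_le_mul_of_nonneg_left (by linarith) hK)⟩
  exact ⟨_, hslim.isHyperbolicWith hc' (by positivity)⟩

/-! ### The Gromov topology of a hyperbolic graph -/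

theorem GeodesicRay.dist_of_le {Γ : SimpleGraph V} (r : GeodesicRay Γ) {m n : ℕ} (h : m ≤ n) :
    (Γ.dist (r m) (r n) : ℝ) = n - m := by
  have h' : (m : ℝ) ≤ n := by exact_mod_cast h
  rw [r.isometry', abs_sub_comm, abs_of_nonneg (by linarith)]

theorem GeodesicRay.gromovProduct_of_le {Γ : SimpleGraph V} (r : GeodesicRay Γ) {m n : ℕ}
    (h : m ≤ n) : gromovProduct Γ (r 0) (r m) (r n) = m := by
  have h1 := r.dist_of_le (Nat.zero_le m)
  have h2 := r.dist_of_le (Nat.zero_le n)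
  have h3 := r.dist_of_le h
  unfold gromovProduct
  rw [dist_comm_real Γ (r m) (r 0), dist_comm_real Γ (r n) (r 0), h1, h2, h3]
  push_cast
  ring

theorem Asymptotic.exists_dist_le {Γ : SimpleGraph V} (hc : Γ.Connected) {r s : GeodesicRay Γ}
    (h : Asymptotic Γ r s) : ∃ C : ℕ, ∀ n, Γ.dist (r n) (s n) ≤ C := by
  obtain ⟨C, hC⟩ := h
  refine ⟨C, fun n => ?_⟩
  have := hC n
  rw [← (hc.preconnected (r n) (s n)).coe_dist_eq_edist] at this
  exact_mod_cast this

theorem GeodesicRay.Joins.asymptotic {Γ : SimpleGraph V} {r s : GeodesicRay Γ} {o : V}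
    {ξ : Boundary Γ} (hr : r.Joins o ξ) (hs : s.Joins o ξ) : Asymptotic Γ r s :=
  Quotient.exact (hr.2.trans hs.2.symm)

/-- The Gromov product of two rays with the same endpoints tends to infinity. -/
theorem GeodesicRay.Joins.eventually_le_gromovProduct {Γ : SimpleGraph V} (hc : Γ.Connected)
    {r s : GeodesicRay Γ} {o : V} {ξ : Boundary Γ} (hr : r.Joins o ξ) (hs : s.Joins o ξ) (R : ℝ) :
    ∀ᶠ i in atTop, R ≤ gromovProduct Γ o (r i) (s i) := by
  obtain ⟨C, hC⟩ := (hr.asymptotic hs).exists_dist_le hc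
  filter_upwards [eventually_ge_atTop ⌈R + C⌉₊] with i hi
  have h1 : R + C ≤ i := Nat.ceil_le.1 hi
  have h2 : (Γ.dist (r i) (s i) : ℝ) ≤ C := by exact_mod_cast hC i
  have h3 := r.dist_of_le (Nat.zero_le i)
  have h4 := s.dist_of_le (Nat.zero_le i)
  rw [hr.1] at h3
  rw [hs.1] at h4
  unfold gromovProduct
  rw [dist_comm_real Γ (r i) o, dist_comm_real Γ (s i) o, h3, h4]
  have : (0 : ℝ) ≤ C := Nat.cast_nonneg C
  push_cast
  linarith

/-- The two memberships may use different rays to `η`; these have products tending to infinity, so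
two uses of the four-point condition suffice. -/
theorem IsHyperbolicWith.basicNhd_subset {Γ : SimpleGraph V} {δ : ℝ} (h : IsHyperbolicWith Γ δ)
    {o : V} {ζ η : Boundary Γ} {R : ℝ}
    (hη : Bordification.bd η ∈ (basicNhd ζ (R + 2 * δ) : Set (Bordification Γ o))) :
    (basicNhd η (R + 2 * δ) : Set (Bordification Γ o)) ⊆ basicNhd ζ R := by
  have hδ := h.nonneg
  obtain ⟨r, s, hr, hs, hrs⟩ := hη
  rw [← prod_atTop_atTop_eq] at hrs
  rintro (y | θ) hp
  · obtain ⟨s', hs', hy⟩ := hp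
    refine ⟨r, hr, ?_⟩
    filter_upwards [hrs.curry] with i hi
    obtain ⟨j, h1, h2, h3⟩ := (hi.and
      ((hs.eventually_le_gromovProduct h.connected hs' (R + 2 * δ)).and hy)).exists
    have h4 := h.le_gromovProduct_trans h1 h2
    linarith [h.le_gromovProduct_trans h4 (le_trans (by linarith) h3)]
  · obtain ⟨s', t, hs', ht, hst⟩ := hp
    rw [← prod_atTop_atTop_eq] at hst
    refine ⟨r, t, hr, ht, ?_⟩
    have hss := hs.eventually_le_gromovProduct h.connected hs' (R + 2 * δ)
    obtain ⟨p, hp, q, hq, hpq⟩ := eventually_prod_iff.1 hrs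
    obtain ⟨p', hp', q', hq', hpq'⟩ := eventually_prod_iff.1 hst
    obtain ⟨j, h1, h2, h3⟩ := (hq.and (hss.and hp')).exists
    rw [← prod_atTop_atTop_eq]
    filter_upwards [hp.prod_mk hq'] with ik hik
    have h4 := h.le_gromovProduct_trans (hpq hik.1 h1) h2
    linarith [h.le_gromovProduct_trans h4 (le_trans (by linarith) (hpq' h3 hik.2))]

/-- A basic neighbourhood is not open by definition, so an open subset `U` containing `ζ` is
exhibited. Without a ray from `o` to `ζ` the set would be empty. -/
theorem IsHyperbolicWith.basicNhd_mem_nhds {Γ : SimpleGraph V} {δ : ℝ} (h : IsHyperbolicWith Γ δ)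
    {o : V} {ζ : Boundary Γ} (hζ : ∃ r : GeodesicRay Γ, r.Joins o ζ) (R : ℝ) :
    (basicNhd ζ R : Set (Bordification Γ o)) ∈ 𝓝 (Bordification.bd ζ) := by
  have hδ := h.nonneg
  have hself : ∀ R : ℝ, Bordification.bd ζ ∈ (basicNhd ζ R : Set (Bordification Γ o)) := by
    intro R
    obtain ⟨r, hr⟩ := hζ
    refine ⟨r, r, hr, hr, ?_⟩
    filter_upwards [eventually_ge_atTop (⌈R⌉₊, ⌈R⌉₊)] with ij hij
    have h1 : R ≤ ij.1 := Nat.ceil_le.1 hij.1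
    have h2 : R ≤ ij.2 := Nat.ceil_le.1 hij.2
    rw [← hr.1]
    rcases le_total ij.1 ij.2 with hle | hle
    · rwa [r.gromovProduct_of_le hle]
    · rwa [gromovProduct_comm, r.gromovProduct_of_le hle]
  let U : Set (Bordification Γ o) :=
    {p | p ∈ basicNhd ζ R ∧ ∀ η, p = .bd η →
      ∃ R', basicNhd η R' ⊆ (basicNhd ζ R : Set (Bordification Γ o))}
  refine mem_of_superset (IsOpen.mem_nhds (s := U) ?_ ⟨hself R, ?_⟩) fun p hp => hp.1
  · rintro η ⟨-, hη⟩
    obtain ⟨R', hR'⟩ := hη η rfl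
    refine ⟨R' + 2 * δ, fun p hp => ⟨hR' (basicNhd_anti η (by linarith) hp), ?_⟩⟩
    rintro θ rfl
    exact ⟨_, (h.basicNhd_subset hp).trans hR'⟩
  · intro η hη
    cases hη
    exact ⟨R, subset_rfl⟩

/-- Sequences of vertices with the same limit on the boundary have Gromov products tending to
infinity. -/
theorem IsHyperbolicWith.eventually_le_gromovProduct_of_tendsto {Γ : SimpleGraph V} {δ : ℝ}
    (h : IsHyperbolicWith Γ δ) {o : V} {ζ : Boundary Γ} (hζ : ∃ r : GeodesicRay Γ, r.Joins o ζ)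
    {ι : Type*} {l : Filter ι} {x y : ι → V}
    (hx : Tendsto (fun i => (Bordification.pt (x i) : Bordification Γ o)) l (𝓝 (.bd ζ)))
    (hy : Tendsto (fun i => (Bordification.pt (y i) : Bordification Γ o)) l (𝓝 (.bd ζ))) (R : ℝ) :
    ∀ᶠ i in l, R ≤ gromovProduct Γ o (x i) (y i) := by
  have hδ := h.nonneg
  have hN := h.basicNhd_mem_nhds (o := o) hζ (R + 2 * δ)
  filter_upwards [hx hN, hy hN] with i ⟨r, hr, h1⟩ ⟨s, hs, h2⟩
  obtain ⟨j, h1, h2, h3⟩ := (h1.and (h2.and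
    (hr.eventually_le_gromovProduct h.connected hs (R + 2 * δ)))).exists
  rw [gromovProduct_comm] at h1
  have h4 := h.le_gromovProduct_trans h1 h3
  linarith [h.le_gromovProduct_trans h4 (le_trans (by linarith) h2)]

theorem tendsto_bd_of_eventually_mem_basicNhd {Γ : SimpleGraph V} {o : V} {ξ : Boundary Γ}
    {ι : Type*} {l : Filter ι} {x : ι → Bordification Γ o}
    (h : ∀ R : ℝ, ∀ᶠ i in l, x i ∈ (basicNhd ξ R : Set (Bordification Γ o))) :
    Tendsto x l (𝓝 (.bd ξ)) := by
  refine tendsto_nhds.2 fun U hU hξ => ?_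
  obtain ⟨R, hR⟩ := hU ξ hξ
  exact (h R).mono fun i hi => hR hi

/-- A geodesic ray converges to its endpoint. -/
theorem GeodesicRay.Joins.tendsto {Γ : SimpleGraph V} {r : GeodesicRay Γ} {o : V}
    {ξ : Boundary Γ} (hr : r.Joins o ξ) :
    Tendsto (fun n => (Bordification.pt (r n) : Bordification Γ o)) atTop (𝓝 (.bd ξ)) := by
  refine tendsto_bd_of_eventually_mem_basicNhd fun R => ?_
  filter_upwards [eventually_ge_atTop ⌈R⌉₊] with n hn
  refine ⟨r, hr, ?_⟩
  filter_upwards [eventually_ge_atTop n] with i hi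
  rw [gromovProduct_comm, ← hr.1, r.gromovProduct_of_le hi]
  exact Nat.ceil_le.1 hn

/-- Two rays from `o` with unbounded Gromov products are asymptotic. -/
theorem IsHyperbolicWith.exists_gromovProduct_rays_le {Γ : SimpleGraph V} {δ : ℝ}
    (h : IsHyperbolicWith Γ δ) {o : V} {ξ η : Boundary Γ} (hne : ξ ≠ η) {r s : GeodesicRay Γ}
    (hr : r.Joins o ξ) (hs : s.Joins o η) :
    ∃ C : ℝ, ∀ m k, gromovProduct Γ o (r m) (s k) ≤ C := by
  by_contra! hcon
  refine hne (hr.2.symm.trans (Eq.trans (Quotient.sound ⟨⌈4 * δ⌉₊, fun n => ?_⟩) hs.2))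
  obtain ⟨m, k, hmk⟩ := hcon n
  have hc := h.connected
  have d1 := r.dist_of_le (Nat.zero_le m)
  have d2 := s.dist_of_le (Nat.zero_le k)
  rw [hr.1] at d1
  rw [hs.1] at d2
  have hm : n ≤ m := by
    have := gromovProduct_le_dist hc o (r m) (s k)
    rw [dist_comm_real, d1] at this
    push_cast at this
    exact_mod_cast (by linarith : (n : ℝ) ≤ m)
  have hk : n ≤ k := by
    have := gromovProduct_le_dist hc o (s k) (r m)
    rw [gromovProduct_comm, dist_comm_real, d2] at this
    push_cast at this
    exact_mod_cast (by linarith : (n : ℝ) ≤ k)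
  have p1 := r.gromovProduct_of_le hm
  have p2 := s.gromovProduct_of_le hk
  rw [hr.1] at p1
  rw [hs.1, gromovProduct_comm] at p2
  -- The chain `r n`, `r m`, `s k`, `s n` gives `(r n|s n)_o ≥ n - 2 * δ`, that is, distance at most
  -- `4 * δ`.
  have p3 := h.le_gromovProduct_trans p1.ge hmk.le
  have p4 := h.le_gromovProduct_trans p3 (le_trans (by linarith [h.nonneg]) p2.ge)
  have e1 := r.dist_of_le (Nat.zero_le n)
  have e2 := s.dist_of_le (Nat.zero_le n)
  rw [hr.1, dist_comm_real] at e1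
  rw [hs.1, dist_comm_real] at e2
  unfold gromovProduct at p4
  rw [e1, e2] at p4
  push_cast at p4
  have : (Γ.dist (r n) (s n) : ℝ) ≤ ⌈4 * δ⌉₊ := le_trans (by linarith) (Nat.le_ceil _)
  rw [← (hc.preconnected (r n) (s n)).coe_dist_eq_edist]
  exact_mod_cast this

/-- In a graph with finite balls, a sequence of vertices leaving every ball converges along an
ultrafilter to the endpoint of a geodesic ray. -/
theorem exists_ray_eventually_mem_basicNhd {Γ : SimpleGraph V} (hc : Γ.Connected) {o : V}
    (hfin : ∀ n : ℕ, {v | Γ.dist o v ≤ n}.Finite) {x : ℕ → V} (𝒰 : Ultrafilter ℕ)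
    (hx : ∀ k : ℕ, ∀ᶠ n in 𝒰, k ≤ Γ.dist o (x n)) :
    ∃ r : GeodesicRay Γ, r 0 = o ∧
      ∀ k : ℕ, ∀ᶠ n in 𝒰, ∀ i ≥ k, (k : ℝ) ≤ gromovProduct Γ o (r i) (x n) := by
  choose γ γ0 γ1 hγ using fun n => exists_isGeodesicSegment hc o (x n)
  have hdist : ∀ n i, i ≤ Γ.dist o (x n) → (Γ.dist o (γ n i) : ℝ) = i := fun n i hi => by
    have := hγ n 0 i (Nat.zero_le _) hi
    rw [γ0] at this
    simpa using this
  -- König's lemma: the `k`-th vertices range over a finite ball, so the ultrafilter selects one of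
  -- them.
  have hlim : ∀ k : ℕ, ∃ v, ∀ᶠ n in 𝒰, γ n k = v := by
    intro k
    have h1 : ∀ᶠ n in 𝒰, ∃ v ∈ {v | Γ.dist o v ≤ k}, γ n k = v := by
      filter_upwards [hx k] with n hn
      refine ⟨_, ?_, rfl⟩
      have := hdist n k hn
      exact le_of_eq (by exact_mod_cast this)
    obtain ⟨v, -, hv⟩ := (Ultrafilter.eventually_exists_mem_iff (hfin k)).1 h1
    exact ⟨v, hv⟩
  choose ρ hρ using hlim
  have hiso : ∀ m n, m ≤ n → (Γ.dist (ρ m) (ρ n) : ℝ) = n - m := by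
    intro m n hmn
    obtain ⟨j, h1, h2, h3⟩ := ((hρ m).and ((hρ n).and (hx n))).exists
    rw [← h1, ← h2, hγ j m n hmn h3]
  let r : GeodesicRay Γ :=
    { toFun := ρ
      isometry' := fun m n => by
        rcases le_total m n with h | h
        · rw [hiso m n h, abs_sub_comm, abs_of_nonneg]
          simpa using h
        · rw [dist_comm_real, hiso n m h, abs_of_nonneg]
          simpa using h }
  have r0 : ρ 0 = o := by
    obtain ⟨j, h1⟩ := (hρ 0).exists
    rw [← h1, γ0]
  refine ⟨r, r0, fun k => ?_⟩
  -- For these `n` the ray and the geodesic to `x n` share the vertex `ρ k`.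
  filter_upwards [hρ k, hx k] with n h1 h2 i hi
  have e1 := hγ n k _ h2 le_rfl
  rw [γ1, h1] at e1
  have e2 := hiso k i hi
  have e3 := hiso 0 i (Nat.zero_le _)
  rw [r0] at e3
  change (k : ℝ) ≤ gromovProduct Γ o (ρ i) (x n)
  unfold gromovProduct
  push_cast at e3
  linarith [dist_triangle_real hc (ρ i) (ρ k) (x n), dist_comm_real Γ (ρ i) (ρ k),
    dist_comm_real Γ (ρ i) o, dist_comm_real Γ (x n) o]

/-! ### Cayley graphs -/

section Cayley

variable {G : Type*} [Group G]

theorem adj_mul_of_mem {S : Set G} (x : G) {s : G} (hs : s ∈ S) (h1 : s ≠ 1) :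
    (SimpleGraph.mulCayley S).Adj x (x * s) := by
  rw [SimpleGraph.mulCayley_adj]
  exact ⟨fun h => h1 (by simpa using h), Or.inl (by simpa using hs)⟩

theorem mulCayley_connected {S : Set G} (hS : Subgroup.closure S = ⊤) :
    (SimpleGraph.mulCayley S).Connected := by
  have step : ∀ (x s : G), s ∈ S → (SimpleGraph.mulCayley S).Reachable x (x * s) := by
    intro x s hs
    by_cases h1 : s = 1
    · simp [h1]
    · exact (adj_mul_of_mem x hs h1).reachable
  have h1 : ∀ g : G, (SimpleGraph.mulCayley S).Reachable 1 g := by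
    intro g
    have hg : g ∈ Subgroup.closure S := hS ▸ Subgroup.mem_top g
    induction hg using Subgroup.closure_induction_right with
    | one => exact SimpleGraph.Reachable.refl _
    | mul_right x hx y hy ih => exact ih.trans (step x y hy)
    | mul_inv_cancel x hx y hy ih =>
      refine ih.trans ?_
      simpa using (step (x * y⁻¹) y hy).symm
  exact { preconnected := fun x y => (h1 x).symm.trans (h1 y), nonempty := ⟨1⟩ }

theorem mulCayley_dist_mul_left {S : Set G} (hc : (SimpleGraph.mulCayley S).Connected)
    (g x y : G) : (SimpleGraph.mulCayley S).dist (g * x) (g * y) =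
      (SimpleGraph.mulCayley S).dist x y := by
  have key : ∀ g x y : G, (SimpleGraph.mulCayley S).dist (g * x) (g * y) ≤
      (SimpleGraph.mulCayley S).dist x y := by
    intro g x y
    obtain ⟨w, hw⟩ := hc.exists_walk_length_eq_dist x y
    let f : SimpleGraph.mulCayley S →g SimpleGraph.mulCayley S :=
      ⟨fun z => g * z, fun h => SimpleGraph.mulCayley_adj_mul_iff_right.2 h⟩
    have := SimpleGraph.dist_le (w.map f)
    rwa [SimpleGraph.Walk.length_map, hw] at this
  exact le_antisymm (key g x y) (by simpa using key g⁻¹ (g * x) (g * y))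

theorem mulCayley_gromovProduct_mul_left {S : Set G}
    (hc : (SimpleGraph.mulCayley S).Connected) (g o x y : G) :
    gromovProduct (SimpleGraph.mulCayley S) (g * o) (g * x) (g * y) =
      gromovProduct (SimpleGraph.mulCayley S) o x y := by
  simp only [gromovProduct, mulCayley_dist_mul_left hc]

theorem finite_mulCayley_ball {S : Set G} (hc : (SimpleGraph.mulCayley S).Connected)
    (hS : S.Finite) (n : ℕ) : {g | (SimpleGraph.mulCayley S).dist 1 g ≤ n}.Finite := by
  induction n with
  | zero =>
    refine (Set.finite_singleton (1 : G)).subset fun g hg => ?_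
    exact (hc.dist_eq_zero_iff.1 (Nat.le_zero.1 hg)).symm
  | succ n ih =>
    refine (ih.union ((ih.image2 (fun a b => a * b) hS).union
      (ih.image2 (fun a b => a * b⁻¹) hS))).subset fun g hg => ?_
    by_cases hgn : (SimpleGraph.mulCayley S).dist 1 g ≤ n
    · exact Or.inl hgn
    · have hd : (SimpleGraph.mulCayley S).dist 1 g = n + 1 := le_antisymm hg (by omega)
      obtain ⟨γ, h0, h1, hγ⟩ := exists_isGeodesicSegment hc 1 g
      rw [hd] at h1 hγ
      have e1 := hγ 0 n (Nat.zero_le _) (by omega)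
      have e2 := hγ n (n + 1) (by omega) le_rfl
      rw [h0] at e1
      rw [h1] at e2
      push_cast at e1 e2
      have e1' : (SimpleGraph.mulCayley S).dist 1 (γ n) ≤ n := by
        exact_mod_cast (by linarith :
          ((SimpleGraph.mulCayley S).dist 1 (γ n) : ℝ) ≤ n)
      have e2' : (SimpleGraph.mulCayley S).dist (γ n) g = 1 := by
        exact_mod_cast (by linarith :
          ((SimpleGraph.mulCayley S).dist (γ n) g : ℝ) = 1)
      rw [SimpleGraph.dist_eq_one_iff_adj, SimpleGraph.mulCayley_adj] at e2'
      rcases e2'.2 with h | h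
      · exact Or.inr (Or.inl ⟨γ n, e1', _, h, by simp⟩)
      · exact Or.inr (Or.inr ⟨γ n, e1', _, h, by simp⟩)

theorem dist_le_mul_dist_of_adj {Γ Γ' : SimpleGraph V} (hc : Γ.Connected) (hc' : Γ'.Connected)
    {J : ℝ} (h : ∀ x y, Γ.Adj x y → (Γ'.dist x y : ℝ) ≤ J) (x y : V) :
    (Γ'.dist x y : ℝ) ≤ J * Γ.dist x y := by
  obtain ⟨w, hw⟩ := hc.exists_walk_length_eq_dist x y
  rw [← hw]
  clear hw
  induction w with
  | nil => simp
  | cons hadj p ih =>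
    rw [SimpleGraph.Walk.length_cons]
    push_cast
    linarith [dist_triangle_real hc' _ _ _ |>.trans (add_le_add (h _ _ hadj) ih)]

theorem exists_mulCayley_dist_le {S S' : Set G} (hS : S.Finite)
    (hc : (SimpleGraph.mulCayley S).Connected) (hc' : (SimpleGraph.mulCayley S').Connected) :
    ∃ J : ℝ, 0 ≤ J ∧ ∀ x y, ((SimpleGraph.mulCayley S').dist x y : ℝ) ≤
      J * (SimpleGraph.mulCayley S).dist x y := by
  -- The largest `S'`-length of a generator in `S`.
  obtain ⟨J, hJ⟩ := (hS.image fun s => (SimpleGraph.mulCayley S').dist 1 s).bddAbove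
  have hJ' : ∀ x y : G, x⁻¹ * y ∈ S → ((SimpleGraph.mulCayley S').dist x y : ℝ) ≤ J := by
    intro x y hs
    have := hJ ⟨_, hs, rfl⟩
    beta_reduce at this
    rw [← mulCayley_dist_mul_left hc' x] at this
    simpa using this
  refine ⟨J, Nat.cast_nonneg J, dist_le_mul_dist_of_adj hc hc' fun x y hxy => ?_⟩
  rcases ((SimpleGraph.mulCayley_adj S x y).1 hxy).2 with h | h
  · exact hJ' x y h
  · rw [dist_comm_real]
    exact hJ' y x h

/-- Hyperbolicity of a group does not depend on the finite generating set. -/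
theorem IsHyperbolicGroup.exists_isHyperbolicWith (hG : IsHyperbolicGroup G) {S : Set G}
    (hfin : S.Finite) (hS : Subgroup.closure S = ⊤) :
    ∃ δ, IsHyperbolicWith (SimpleGraph.mulCayley S) δ := by
  obtain ⟨S₀, hfin₀, -, hyp⟩ := hG
  obtain ⟨δ, hδ⟩ := hyp.exists_isHyperbolicWith
  have hc := mulCayley_connected hS
  obtain ⟨J, hJ, h1⟩ := exists_mulCayley_dist_le hfin hc hδ.connected
  obtain ⟨K, hK, h2⟩ := exists_mulCayley_dist_le hfin₀ hδ.connected hc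
  exact hδ.exists_of_biLipschitz hc hJ hK h1 h2

end Cayley

/-! ### Boundary points and rays from the base point -/

/-- In a hyperbolic graph with finite balls every boundary point is the endpoint of a ray from
the base point. -/
theorem IsHyperbolicWith.exists_joins {Γ : SimpleGraph V} {δ : ℝ} (h : IsHyperbolicWith Γ δ)
    {o : V} (hfin : ∀ n : ℕ, {v | Γ.dist o v ≤ n}.Finite) (ζ : Boundary Γ) :
    ∃ r : GeodesicRay Γ, r.Joins o ζ := by
  have hc := h.connected
  have hδ := h.nonneg
  obtain ⟨s, rfl⟩ := Quotient.exists_rep ζ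
  have hs : ∀ n : ℕ, (n : ℝ) - Γ.dist o (s 0) ≤ Γ.dist o (s n) := fun n => by
    have := s.dist_of_le (Nat.zero_le n)
    push_cast at this
    linarith [dist_triangle_real hc (s 0) o (s n), dist_comm_real Γ o (s 0)]
  have hesc : ∀ k : ℕ, ∀ᶠ n in (hyperfilter ℕ : Filter ℕ), k ≤ Γ.dist o (s n) := fun k => by
    refine Nat.hyperfilter_le_atTop ?_
    filter_upwards [eventually_ge_atTop (k + Γ.dist o (s 0))] with n hn
    have hn' : (k : ℝ) + Γ.dist o (s 0) ≤ n := by exact_mod_cast hn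
    exact_mod_cast (by linarith [hs n] : (k : ℝ) ≤ Γ.dist o (s n))
  obtain ⟨r, r0, hr⟩ := exists_ray_eventually_mem_basicNhd hc hfin (hyperfilter ℕ) hesc
  -- With `d` the distance from `o` to `s 0`, the product `(r n|s n)_o` is at least `n - d - δ`,
  -- while `s n` is at distance at most `n + d` from `o`.
  refine ⟨r, r0, Quotient.sound ⟨⌈3 * (Γ.dist o (s 0) : ℝ) + 2 * δ⌉₊, fun n => ?_⟩⟩
  obtain ⟨m, h1, hnm⟩ := ((hr n).and (Nat.hyperfilter_le_atTop (eventually_ge_atTop n))).exists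
  have p1 := h1 n le_rfl
  have p2 := gromovProduct_le_add_dist hc (s 0) o (s m) (s n)
  rw [gromovProduct_comm, s.gromovProduct_of_le hnm, dist_comm_real] at p2
  have hd := dist_nonneg_real Γ o (s 0)
  have p3 := h.le_gromovProduct_trans (a := n - Γ.dist o (s 0)) (le_trans (by linarith) p1)
    (by linarith)
  have e1 := r.dist_of_le (Nat.zero_le n)
  have e2 := s.dist_of_le (Nat.zero_le n)
  rw [r0] at e1
  unfold gromovProduct at p3
  push_cast at e1 e2
  have : (Γ.dist (r n) (s n) : ℝ) ≤ ⌈3 * (Γ.dist o (s 0) : ℝ) + 2 * δ⌉₊ :=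
    le_trans (by linarith [dist_triangle_real hc (s n) (s 0) o, dist_comm_real Γ (s n) (s 0),
      dist_comm_real Γ (s 0) o, dist_comm_real Γ (r n) o]) (Nat.le_ceil _)
  rw [← (hc.preconnected (r n) (s n)).coe_dist_eq_edist]
  exact_mod_cast this

/-! ### Cannon–Thurston maps -/

section Subgroups

variable {G : Type*} [Group G] {H : Subgroup G} {T : Set H} {S : Set G}

/-- Mitra's criterion: if the inclusion extends continuously to the boundaries, then Gromov
products in `G` of elements of `H` are large as soon as those in `H` are. -/
theorem exists_le_gromovProduct_of_continuous {δ δ' : ℝ}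
    (hT : IsHyperbolicWith (SimpleGraph.mulCayley T) δ)
    (hS : IsHyperbolicWith (SimpleGraph.mulCayley S) δ') (hTfin : T.Finite) (hSfin : S.Finite)
    {f : Boundary (SimpleGraph.mulCayley T) → Boundary (SimpleGraph.mulCayley S)}
    (hf : Continuous (extendInclusion H T S f)) (D : ℝ) :
    ∃ N : ℝ, ∀ x y : H, N ≤ gromovProduct (SimpleGraph.mulCayley T) 1 x y →
      D ≤ gromovProduct (SimpleGraph.mulCayley S) 1 (x : G) y := by
  by_contra! hcon
  choose x y hxy hD using fun n : ℕ => hcon n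
  have hesc : ∀ k : ℕ, ∀ᶠ n in (hyperfilter ℕ : Filter ℕ),
      k ≤ (SimpleGraph.mulCayley T).dist 1 (x n) := fun k => by
    refine Nat.hyperfilter_le_atTop ?_
    filter_upwards [eventually_ge_atTop k] with n hn
    have h1 := (hxy n).trans (gromovProduct_le_dist hT.connected 1 (x n) (y n))
    rw [dist_comm_real] at h1
    exact hn.trans (by exact_mod_cast h1)
  obtain ⟨r, r0, hr⟩ := exists_ray_eventually_mem_basicNhd hT.connected
    (finite_mulCayley_ball hT.connected hTfin) (hyperfilter ℕ) hesc
  let ξ : Boundary (SimpleGraph.mulCayley T) := Quotient.mk _ r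
  have hrξ : r.Joins 1 ξ := ⟨r0, rfl⟩
  have hx : Tendsto (fun n => (Bordification.pt (x n) :
      Bordification (SimpleGraph.mulCayley T) 1)) (hyperfilter ℕ) (𝓝 (.bd ξ)) := by
    refine tendsto_bd_of_eventually_mem_basicNhd fun R => ?_
    filter_upwards [hr ⌈R⌉₊] with n hn
    refine ⟨r, hrξ, ?_⟩
    filter_upwards [eventually_ge_atTop ⌈R⌉₊] with i hi
    exact (Nat.le_ceil R).trans (hn i hi)
  -- `y` follows `x` to the same limit because `(x n|y n)_1 ≥ n`.
  have hy : Tendsto (fun n => (Bordification.pt (y n) :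
      Bordification (SimpleGraph.mulCayley T) 1)) (hyperfilter ℕ) (𝓝 (.bd ξ)) := by
    refine tendsto_bd_of_eventually_mem_basicNhd fun R => ?_
    filter_upwards [hr ⌈R + δ⌉₊, Nat.hyperfilter_le_atTop (eventually_ge_atTop ⌈R + δ⌉₊)]
      with n hn hn'
    refine ⟨r, hrξ, ?_⟩
    filter_upwards [eventually_ge_atTop ⌈R + δ⌉₊] with i hi
    linarith [hT.le_gromovProduct_trans ((Nat.le_ceil _).trans (hn i hi))
      ((Nat.ceil_le.1 hn').trans (hxy n))]
  have hx' := (hf.tendsto (.bd ξ)).comp hx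
  have hy' := (hf.tendsto (.bd ξ)).comp hy
  obtain ⟨n, hn⟩ := (hS.eventually_le_gromovProduct_of_tendsto (x := fun n => (x n : G))
    (y := fun n => (y n : G)) (hS.exists_joins (finite_mulCayley_ball hS.connected hSfin) (f ξ))
    hx' hy' D).exists
  exact absurd hn (not_le.2 (hD n))

theorem IsQuasigeodesicIn.isQuasigeodesicSegment {K ε : ℝ} (hK : 1 ≤ K)
    {r : GeodesicRay (SimpleGraph.mulCayley T)} (h : IsQuasigeodesicIn H T S K ε r) (N : ℕ) :
    IsQuasigeodesicSegment (SimpleGraph.mulCayley S) K ε (K + ε) (fun n => (r n : G)) N := by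
  refine ⟨fun i _ => ?_, fun i j hij _ => ?_⟩
  · have := (h i (i + 1)).2
    push_cast at this
    rw [show (i : ℝ) - (i + 1) = -1 by ring, abs_neg, abs_one, mul_one] at this
    exact this
  · have := (h i j).1
    have hij' : (i : ℝ) ≤ j := by exact_mod_cast hij
    rw [abs_sub_comm, abs_of_nonneg (by linarith), sub_le_iff_le_add, one_div,
      inv_mul_le_iff₀ (by linarith)] at this
    exact this

end Subgroups

end HypGroup

/-! ### Continuity against a quasigeodesic ray -/

open HypGroup

theorem corollary4p5 {G : Type*} [Group G] (H : Subgroup G)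
    (hG : HypGroup.IsHyperbolicGroup G) (hH : HypGroup.IsHyperbolicGroup H)
    (T : Set H) (S : Set G) (hTfin : T.Finite) (hSfin : S.Finite)
    (hT : Subgroup.closure T = ⊤) (hS : Subgroup.closure S = ⊤)
    (hTS : ∀ t ∈ T, (t : G) ∈ S)
    (ξ η : HypGroup.Boundary (SimpleGraph.mulCayley T))
    (hξη : (ξ, η) ∈ HypGroup.weakCTPrelamination H T S)
    (r : HypGroup.GeodesicRay (SimpleGraph.mulCayley T)) (hr : r.Joins 1 ξ)
    (K ε : ℝ) (hK : 1 ≤ K) (hε : 0 ≤ ε)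
    (hqg : HypGroup.IsQuasigeodesicIn H T S K ε r) :
    ¬ HypGroup.AdmitsCannonThurstonMap H T S := by
  rintro ⟨f, hf⟩
  obtain ⟨δT, hypT⟩ := hH.exists_isHyperbolicWith hTfin hT
  obtain ⟨δ, hypS⟩ := hG.exists_isHyperbolicWith hSfin hS
  have hcT := hypT.connected
  have hcS := hypS.connected
  obtain ⟨hne, r', s, hr', hs, ζ, hr'ζ, hsζ⟩ := hξη
  have hjoin := hypS.exists_joins (finite_mulCayley_ball hcS hSfin)
  -- in `G` the two rays have the same limit
  have hrs : ∀ R : ℝ, ∀ᶠ m in atTop,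
      R ≤ gromovProduct (SimpleGraph.mulCayley S) 1 (r m : G) (s m) := fun R => by
    -- The quasigeodesic `r` need not be the ray `r'` known to land at `ζ`; continuity compares them
    -- through `f ξ`.
    have t1 := (hf.tendsto (.bd ξ)).comp hr.tendsto
    have t2 := (hf.tendsto (.bd ξ)).comp hr'.tendsto
    filter_upwards [hypS.eventually_le_gromovProduct_of_tendsto (x := fun n => (r n : G))
      (y := fun n => (r' n : G)) (hjoin (f ξ)) t1 t2 (R + δ),
      hypS.eventually_le_gromovProduct_of_tendsto (hjoin ζ) hr'ζ hsζ (R + δ)] with m h1 h2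
    linarith [hypS.le_gromovProduct_trans h1 h2]
  obtain ⟨C, hC⟩ := hypT.exists_gromovProduct_rays_le hne hr hs
  obtain ⟨A, -, hA⟩ := hypS.exists_gromovProduct_quasigeodesic_le (K := K) (ε := ε) (J := K + ε)
    (by linarith) (by linarith)
  -- One use of the four-point condition costs `δ`, and the `1` makes the contradiction with `A`
  -- strict.
  obtain ⟨N, hN⟩ := exists_le_gromovProduct_of_continuous hypT hypS hTfin hSfin hf (A + δ + 1)
  obtain ⟨n, hn⟩ := exists_nat_ge (N + C)
  obtain ⟨m, hm, hnm⟩ := ((hrs (A + δ + 1 + (SimpleGraph.mulCayley S).dist 1 (r n : G))).and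
    (eventually_ge_atTop n)).exists
  have hback : A + δ + 1 ≤
      gromovProduct (SimpleGraph.mulCayley S) (r n : G) (s m : G) (1 : G) := by
    -- Translating `r n` to `1` is an isometry of both Cayley graphs, so the criterion, stated at
    -- `1`, applies at `r n`.
    have h1 : N ≤ gromovProduct (SimpleGraph.mulCayley T) 1 ((r n)⁻¹ * s m) ((r n)⁻¹ * 1) := by
      rw [← mulCayley_gromovProduct_mul_left hcT (r n)]
      simp only [mul_one, mul_inv_cancel_left, mul_inv_cancel]
      have h2 := gromovProduct_add_gromovProduct (SimpleGraph.mulCayley T) 1 (r n) (s m)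
      have h3 := r.dist_of_le (Nat.zero_le n)
      rw [hr.1] at h3
      have h4 := hC n m
      rw [gromovProduct_comm] at h4
      push_cast at h3
      linarith
    have h5 := hN _ _ h1
    rw [← mulCayley_gromovProduct_mul_left hcS (r n : G)] at h5
    simpa using h5
  have hfwd := gromovProduct_le_add_dist hcS 1 (r n : G) (r m : G) (s m : G)
  have h1 := hypS.le_gromovProduct_trans (hm.trans hfwd |> fun h => by linarith) hback
  have h2 := hA _ m (hqg.isQuasigeodesicSegment hK m) n hnm
  rw [gromovProduct_comm] at h2
  simp only [hr.1, Subgroup.coe_one] at h2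
  linarith
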